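/- \textbf{Setting.} Let $(X_i,Y_i,Z_i)$, $i=1,2,\dots$, be i.i.d. copies of $(X,Y,Z)$ with $Y$ real valued. Let $\Theta$ be a compact subset of a real normed space and let $T$ be a separable topological space. Let $\mathcal G=\{g(\cdot;\theta):\theta\in\Theta\}$ be real measurable functions of $X$ and let $\mathcal F=\{f(\cdot;\tau):\tau\in T\}$ be real measurable functions of $Z$. Suppose that for some $\theta_0\in\Theta$ we have $Y=g(X;\theta_0)+\epsilon$ with $\mathbb E[\epsilon\mid Z]=0$. Write $\psi(f;\theta)=\mathbb E[f(Z)(Y-g(X;\theta))]$, $\Theta_0=\{\theta\in\Theta:\psi(f;\theta)=0\ \text{for all } f\in\mathcal F\}$ and, for sample size $n$ and $\theta,\theta'\in\Theta$, $\tau\in T$, $$U_{\theta'}(\theta,\tau)=\frac1n\sum_{i=1}^n f(Z_i;\tau)(Y_i-g(X_i;\theta))-\frac1{4n}\sum_{i=1}^n f(Z_i;\tau)^2(Y_i-g(X_i;\theta'))^2 .$$ \textbf{Assumptions.} (a) Bounded complexity: as $n\to\infty$, $$\frac1{2^n}\sum_{\xi\in\{-1,1\}^n}\mathbb E\sup_{\tau\in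 T}\frac1n\sum_{i=1}^n\xi_i f(Z_i;\tau)\to0,\qquad \frac1{2^n}\sum_{\xi\in\{-1,1\}^n}\mathbb E\sup_{\theta\in\Theta}\frac1n\sum_{i=1}^n\xi_i g(X_i;\theta)\to0 .$$ (b) Absolutely star shaped: $\lambda f\in\mathcal F$ whenever $f\in\mathcal F$ and $|\lambda|\le1$. (c) Continuity: for all $x$ and $z$, $g(x;\theta)$ is continuous in $\theta\in\Theta$ and $f(z;\tau)$ is continuous in $\tau\in T$. (d) Boundedness: $Y$, $\sup_{\theta\in\Theta}|g(X;\theta)|$ and $\sup_{\tau\in T}|f(Z;\tau)|$ are almost surely bounded by a constant. (e) Identification of $g$: for all $\theta_1,\theta_2\in\Theta_0$ the functions $g(\cdot;\theta_1)$ and $g(\cdot;\theta_2)$ are identical. \textbf{Conclusion.} Let $\tilde\theta_n\in\Theta$ be any (possibly data-dependent) sequence, and let $\hat\theta_n\in\Theta$, $\hat\tau_n\in T$ be any (possibly data-dependent) approximate equilibrium, i.e., almost surely for every $n$, $$\sup_{\tau\in T}U_{\tilde\theta_n}(\hat\theta_n,\tau)-o_p(1)\le U_{\tilde\theta_n}(\hat\theta_n,\hat\tau_n)\le\inf_{\theta\in\Theta}U_{\tilde\theta_n}(\theta,\hat\tau_n)+o_p(1).$$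 Then $\inf_{\theta\in\Theta_0}\|\hat\theta_n-\theta\|\to0$ in probability as $n\to\infty$. -/

import Mathlib

open MeasureTheory ProbabilityTheory Filter Topology

noncomputable section

namespace DeepGMM

/-- One observation `w = (x, y, z)`: treatment `x`, outcome `y`, instrument `z`. -/
abbrev Obs (𝒳 𝒵 : Type*) := 𝒳 × ℝ × 𝒵

section

variable {Ω 𝒳 𝒵 E T : Type*}

/-- The instrumental variable model `Y = g(X; θ₀) + ε` with `E[ε ∣ Z] = 0`, where `P` is the
joint law of `(X, Y, Z)` and `ε = Y - g(X; θ₀)`. -/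
def IVModel [MeasurableSpace 𝒳] [MeasurableSpace 𝒵] (P : Measure (Obs 𝒳 𝒵))
    (g : 𝒳 → E → ℝ) (θ₀ : E) : Prop :=
  P[fun w : Obs 𝒳 𝒵 => w.2.1 - g w.1 θ₀ |
      MeasurableSpace.comap (fun w : Obs 𝒳 𝒵 => w.2.2) inferInstance] =ᵐ[P] fun _ => (0 : ℝ)

/-- The moment `ψ(f(·; τ); θ) = E[f(Z; τ) (Y - g(X; θ))]`. -/
def moment [MeasurableSpace 𝒳] [MeasurableSpace 𝒵] (P : Measure (Obs 𝒳 𝒵))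
    (f : 𝒵 → T → ℝ) (g : 𝒳 → E → ℝ) (τ : T) (θ : E) : ℝ :=
  ∫ w, f w.2.2 τ * (w.2.1 - g w.1 θ) ∂P

/-- The identified set `Θ₀`: the parameters in `Θ` that satisfy every moment condition. -/
def identifiedSet [MeasurableSpace 𝒳] [MeasurableSpace 𝒵] (P : Measure (Obs 𝒳 𝒵))
    (f : 𝒵 → T → ℝ) (g : 𝒳 → E → ℝ) (Θ : Set E) : Set E :=
  {θ | θ ∈ Θ ∧ ∀ τ : T, moment P f g τ θ = 0}

/-- The payoff `U_{θ'}(θ, τ)` of the game on the first `n` observations of `d`. -/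
def payoff (f : 𝒵 → T → ℝ) (g : 𝒳 → E → ℝ) (n : ℕ) (d : ℕ → Obs 𝒳 𝒵)
    (θ' θ : E) (τ : T) : ℝ :=
  (1 / (n : ℝ)) * ∑ i ∈ Finset.range n, f (d i).2.2 τ * ((d i).2.1 - g (d i).1 θ)
    - (1 / (4 * (n : ℝ))) *
      ∑ i ∈ Finset.range n, (f (d i).2.2 τ) ^ 2 * ((d i).2.1 - g (d i).1 θ') ^ 2

/-- The Rademacher complexity, at sample size `n`, of the class of functions `h(·; a)`, `a : ι`,
along the random sequence `V`; the signs `ξ` range over `{-1, 1}ⁿ`. -/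
def rademacher {𝒱 ι : Type*} [MeasurableSpace Ω] (μ : Measure Ω) (V : ℕ → Ω → 𝒱)
    (h : 𝒱 → ι → ℝ) (n : ℕ) : ℝ :=
  (1 / (2 : ℝ) ^ n) * ∑ ξ ∈ Fintype.piFinset (fun _ : Fin n => ({-1, 1} : Finset ℝ)),
    ∫ ω, (⨆ a : ι, (1 / (n : ℝ)) * ∑ i : Fin n, ξ i * h (V i ω) a) ∂μ

/-- The class of functions `f(·; τ)` is absolutely star shaped. -/
def AbsolutelyStarShaped (f : 𝒵 → T → ℝ) : Prop :=
  ∀ (τ : T) (c : ℝ), |c| ≤ 1 → ∃ τ' : T, ∀ z, f z τ' = c * f z τ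

/-- `Y`, `sup_{θ ∈ Θ} |g(X; θ)|` and `sup_τ |f(Z; τ)|` are bounded random variables. -/
def BoundedClasses [MeasurableSpace 𝒳] [MeasurableSpace 𝒵] (P : Measure (Obs 𝒳 𝒵))
    (f : 𝒵 → T → ℝ) (g : 𝒳 → E → ℝ) (Θ : Set E) : Prop :=
  ∃ B : ℝ, ∀ᵐ w ∂P, |w.2.1| ≤ B ∧ (∀ θ ∈ Θ, |g w.1 θ| ≤ B) ∧ ∀ τ : T, |f w.2.2 τ| ≤ B

/-- `r n = o_p(1)`. -/
def IsLittleOp [MeasurableSpace Ω] (μ : Measure Ω) (r : ℕ → Ω → ℝ) : Prop :=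
  TendstoInMeasure μ r atTop (fun _ => (0 : ℝ))

/-- `(θhat n, τhat n)` is an approximate equilibrium of the game with payoff `U_{θtilde n}`:
almost surely `sup_τ U(θhat, τ) - o_p(1) ≤ U(θhat, τhat) ≤ inf_θ U(θ, τhat) + o_p(1)`. -/
def IsApproxEquilibrium [MeasurableSpace Ω] (μ : Measure Ω) (D : ℕ → Ω → Obs 𝒳 𝒵)
    (f : 𝒵 → T → ℝ) (g : 𝒳 → E → ℝ) (Θ : Set E)
    (θtilde θhat : ℕ → Ω → E) (τhat : ℕ → Ω → T) : Prop :=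
  ∃ r s : ℕ → Ω → ℝ, IsLittleOp μ r ∧ IsLittleOp μ s ∧
    ∀ n, ∀ᵐ ω ∂μ,
      (⨆ τ : T, payoff f g n (fun i => D i ω) (θtilde n ω) (θhat n ω) τ) - r n ω
          ≤ payoff f g n (fun i => D i ω) (θtilde n ω) (θhat n ω) (τhat n ω) ∧
      payoff f g n (fun i => D i ω) (θtilde n ω) (θhat n ω) (τhat n ω)
          ≤ (⨅ θ : Θ, payoff f g n (fun i => D i ω) (θtilde n ω) θ (τhat n ω)) + s n ω

end

end DeepGMM

end

/-!
The estimate behind the theorem is a comparison of strategies in the game. Almost surely the data obey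
a common bound `B`, so the quadratic penalty of the payoff at a function `c f(·; τ)` is at most
`c² B⁴`, while its linear part is `c ψₙ(f(·; τ); θ)`. Playing `θ₀` instead of `θ̂` and `c f(·; τ)`, which
is in the class by star-shapedness, instead of the function at `τ̂` gives, for `0 ≤ c ≤ 1`,
`c ψₙ(f(·; τ); θ̂) - c² B⁴ ≤ sup_τ ψₙ(f(·; τ); θ₀) + o_p(1)`
(`DeepGMM.le_of_approxEquilibrium`). Two probabilistic facts finish the argument.

* The supremum on the right is `o_p(1)` (`DeepGMM.tendstoInMeasure_iSup_sampleMoment`). The moments at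
  `θ₀` have mean zero by the model, so its expectation is bounded by symmetrization
  (`DeepGMM.integral_iSup_sum_le_add`) and by a contraction that removes the bounded multiplier
  `Y - g(X; θ₀)` (`DeepGMM.sum_signs_iSup_mul_le`), leaving the Rademacher complexity of the class
  of `f`. Separability of `T` reduces all suprema to countable ones.
* On the compact set `K` of parameters at distance at least `ε` from the identified set, with
  probability tending to one every `θ` has a `τ` with `ψₙ(f(·; τ); θ) > c₀`, for a fixed `c₀ > 0`
  (`DeepGMM.exists_tendsto_measure_sampleMoment`). Each `θ` in `K` has a positive moment; a measurable
  lower envelope near `θ` (`DeepGMM.exists_lower_envelope`) and the law of large numbers make this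
  uniform in a neighbourhood, and finitely many neighbourhoods cover `K`.

If `θ̂` were in `K`, the displayed bound with `c` small compared with `c₀ / B⁴` would bound a fixed
positive number by an `o_p(1)` term, so this happens with probability tending to zero.
The identified set contains `θ₀`, so the distance to it is a genuine one.
-/

namespace DeepGMM

/-! ### Suprema over dense sequences -/

theorem iSup_denseRange_eq {T : Type*} [TopologicalSpace T] [Nonempty T] {h : T → ℝ}
    (hh : Continuous h) {u : ℕ → T} (hu : DenseRange u) :
    ⨆ k, h (u k) = ⨆ t, h t := by
  have key : ∀ M, (∀ k, h (u k) ≤ M) → ∀ t, h t ≤ M := fun M hM t =>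
    hu.induction_on (p := fun t => h t ≤ M) t (isClosed_le hh continuous_const) hM
  by_cases hb : BddAbove (Set.range h)
  · have hb' : BddAbove (Set.range fun k => h (u k)) :=
      hb.mono (Set.range_comp_subset_range u h)
    exact le_antisymm (ciSup_le fun k => le_ciSup hb (u k))
      (ciSup_le (key _ fun k => le_ciSup hb' k))
  · have hb' : ¬ BddAbove (Set.range fun k => h (u k)) := by
      rintro ⟨M, hM⟩
      refine hb ⟨M, ?_⟩
      rintro _ ⟨t, rfl⟩
      exact key M (fun k => hM ⟨k, rfl⟩) t
    rw [Real.iSup_of_not_bddAbove hb, Real.iSup_of_not_bddAbove hb']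

/-! ### Sums over sign vectors -/

/-- The sign vectors `{-1, 1}ⁿ`. -/
noncomputable abbrev signs (n : ℕ) : Finset (Fin n → ℝ) :=
  Fintype.piFinset fun _ : Fin n => ({-1, 1} : Finset ℝ)

theorem mem_signs {n : ℕ} {ξ : Fin n → ℝ} : ξ ∈ signs n ↔ ∀ i, ξ i = -1 ∨ ξ i = 1 := by
  simp [signs]

theorem card_signs (n : ℕ) : (signs n).card = 2 ^ n := by
  have : ({-1, 1} : Finset ℝ).card = 2 := Finset.card_pair (by norm_num)
  simp [signs, this]

theorem mul_mem_signs {n : ℕ} {ξ η : Fin n → ℝ} (hξ : ξ ∈ signs n) (hη : η ∈ signs n) :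
    ξ * η ∈ signs n := mem_signs.2 fun i => by
  rcases mem_signs.1 hη i with h | h <;> rcases mem_signs.1 hξ i with h' | h' <;> simp [h, h']

theorem sum_signs_mul_right {n : ℕ} {η : Fin n → ℝ} (hη : η ∈ signs n)
    (s : (Fin n → ℝ) → ℝ) :
    ∑ ξ ∈ signs n, s (ξ * η) = ∑ ξ ∈ signs n, s ξ := by
  have hη' := mem_signs.1 hη
  have hsq : η * η = 1 := by
    ext i
    rcases hη' i with h | h <;> simp [h]
  have hmem : ∀ ξ ∈ signs n, ξ * η ∈ signs n := fun ξ hξ => mul_mem_signs hξ hη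
  refine Finset.sum_bij' (fun ξ _ => ξ * η) (fun ξ _ => ξ * η) hmem hmem ?_ ?_ ?_
  · intro ξ _
    simp [mul_assoc, hsq]
  · intro ξ _
    simp [mul_assoc, hsq]
  · simp

theorem sum_signs_neg {n : ℕ} (s : (Fin n → ℝ) → ℝ) :
    ∑ ξ ∈ signs n, s (-ξ) = ∑ ξ ∈ signs n, s ξ := by
  have := sum_signs_mul_right (η := (-1 : Fin n → ℝ)) (mem_signs.2 fun i => by simp) s
  simpa using this

/-- Every vector of the cube `[-1, 1]ⁿ` is a convex combination of sign vectors, namely the mean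
of independent signs. -/
theorem exists_weights_signs {n : ℕ} {e : Fin n → ℝ} (he : ∀ i, |e i| ≤ 1) :
    ∃ w : (Fin n → ℝ) → ℝ, (∀ η ∈ signs n, 0 ≤ w η) ∧ ∑ η ∈ signs n, w η = 1 ∧
      ∀ i, ∑ η ∈ signs n, w η * η i = e i := by
  have hne : (-1 : ℝ) ≠ 1 := by norm_num
  refine ⟨fun η => ∏ i, (1 + η i * e i) / 2, ?_, ?_, ?_⟩
  · intro η hη
    refine Finset.prod_nonneg fun i _ => ?_
    have := abs_le.1 (he i)
    rcases mem_signs.1 hη i with h | h <;> rw [h] <;> linarith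
  · have := Finset.prod_univ_sum (fun _ : Fin n => ({-1, 1} : Finset ℝ))
      (fun i s => (1 + s * e i) / 2)
    rw [← this]
    refine Finset.prod_eq_one fun i _ => ?_
    rw [Finset.sum_pair hne]
    ring
  · intro i
    have := Finset.prod_univ_sum (fun _ : Fin n => ({-1, 1} : Finset ℝ))
      (fun j s => (1 + s * e j) / 2 * if j = i then s else 1)
    simp only [Finset.prod_mul_distrib, Finset.prod_ite_eq', Finset.mem_univ, if_true] at this
    rw [← this, Finset.prod_eq_single i]
    · rw [Finset.sum_pair hne]
      simp only [if_true]
      ring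
    · intro j _ hj
      rw [Finset.sum_pair hne]
      simp only [hj, if_false]
      ring
    · simp

theorem bddAbove_range_of_abs_le {ι : Type*} {u : ι → ℝ} {A : ℝ} (h : ∀ k, |u k| ≤ A) :
    BddAbove (Set.range u) := by
  refine ⟨A, ?_⟩
  rintro _ ⟨k, rfl⟩
  exact (abs_le.1 (h k)).2

theorem abs_iSup_le_of_abs_le {ι : Type*} [Nonempty ι] {u : ι → ℝ} {A : ℝ}
    (h : ∀ k, |u k| ≤ A) : |⨆ k, u k| ≤ A := by
  obtain ⟨k⟩ := ‹Nonempty ι›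
  exact abs_le.2 ⟨(abs_le.1 (h k)).1.trans (le_ciSup (bddAbove_range_of_abs_le h) k),
    ciSup_le fun k => (abs_le.1 (h k)).2⟩

theorem abs_sum_mul_le {ι : Type*} (s : Finset ι) {c u : ι → ℝ} {A : ℝ}
    (hc : ∀ i ∈ s, |c i| ≤ 1) (hu : ∀ i ∈ s, |u i| ≤ A) :
    |∑ i ∈ s, c i * u i| ≤ s.card * A := by
  refine (Finset.abs_sum_le_sum_abs _ _).trans ?_
  rw [← nsmul_eq_mul]
  refine Finset.sum_le_card_nsmul _ _ _ fun i hi => ?_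
  rw [abs_mul]
  exact (mul_le_of_le_one_left (abs_nonneg _) (hc i hi)).trans (hu i hi)

theorem abs_of_mem_signs {n : ℕ} {ξ : Fin n → ℝ} (hξ : ξ ∈ signs n) (i : Fin n) :
    |ξ i| = 1 := by
  rcases mem_signs.1 hξ i with h | h <;> simp [h]

/-- Contraction for a linear multiplier: multiplying the coordinates by factors of size at most `C`
increases a Rademacher sum by a factor of at most `C`. Averaging over sign vectors `η` with mean
`e / C` reduces this to factors `±C`, which are absorbed into the signs `ξ`. -/
theorem sum_signs_iSup_mul_le {n : ℕ} {ι : Type*} [Nonempty ι] {a : ι → Fin n → ℝ} {A C : ℝ}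
    (ha : ∀ k i, |a k i| ≤ A) {e : Fin n → ℝ} (hC : 0 < C) (he : ∀ i, |e i| ≤ C) :
    ∑ ξ ∈ signs n, ⨆ k, ∑ i, ξ i * (a k i * e i) ≤
      C * ∑ ξ ∈ signs n, ⨆ k, ∑ i, ξ i * a k i := by
  obtain ⟨w, hw0, hw1, hwe⟩ := exists_weights_signs (e := fun i => e i / C) fun i => by
    rw [abs_div, abs_of_pos hC]
    exact (div_le_one hC).2 (he i)
  set s : (Fin n → ℝ) → ℝ := fun ξ => ⨆ k, ∑ i, ξ i * a k i with hs
  have hle : ∀ ξ ∈ signs n, ∀ k, ∑ i, ξ i * a k i ≤ s ξ := fun ξ hξ k =>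
    le_ciSup (bddAbove_range_of_abs_le fun k =>
      abs_sum_mul_le _ (fun i _ => (abs_of_mem_signs hξ i).le) fun i _ => ha k i) k
  have hstep : ∀ ξ ∈ signs n, ⨆ k, ∑ i, ξ i * (a k i * e i) ≤
      C * ∑ η ∈ signs n, w η * s (ξ * η) := by
    intro ξ hξ
    refine ciSup_le fun k => ?_
    calc ∑ i, ξ i * (a k i * e i)
        = ∑ i, C * (ξ i * a k i * ∑ η ∈ signs n, w η * η i) := by
          refine Finset.sum_congr rfl fun i _ => ?_
          rw [hwe]
          field_simp
      _ = C * ∑ η ∈ signs n, w η * ∑ i, (ξ * η) i * a k i := by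
          simp only [Finset.mul_sum, Pi.mul_apply]
          rw [Finset.sum_comm]
          refine Finset.sum_congr rfl fun η _ => Finset.sum_congr rfl fun i _ => ?_
          ring
      _ ≤ C * ∑ η ∈ signs n, w η * s (ξ * η) := by
          gcongr with η hη
          · exact hw0 η hη
          · exact hle _ (mul_mem_signs hξ hη) k
  calc _ ≤ ∑ ξ ∈ signs n, C * ∑ η ∈ signs n, w η * s (ξ * η) := Finset.sum_le_sum hstep
    _ = C * ∑ η ∈ signs n, w η * ∑ ξ ∈ signs n, s (ξ * η) := by
        rw [← Finset.mul_sum, Finset.sum_comm]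
        simp only [Finset.mul_sum]
    _ = C * ∑ ξ ∈ signs n, s ξ := by
        rw [Finset.sum_congr rfl fun η hη => by rw [sum_signs_mul_right hη s],
          ← Finset.sum_mul, hw1, one_mul]

/-! ### Symmetrization -/

theorem integrable_iSup_of_abs_le {Ω ι : Type*} [MeasurableSpace Ω] {μ : Measure Ω}
    [IsFiniteMeasure μ] [Countable ι] [Nonempty ι] {u : ι → Ω → ℝ}
    (hu : ∀ k, AEMeasurable (u k) μ) {A : ℝ} (hA : ∀ k ω, |u k ω| ≤ A) :
    Integrable (fun ω => ⨆ k, u k ω) μ :=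
  .of_bound (AEMeasurable.iSup hu).aestronglyMeasurable A
    (.of_forall fun ω => abs_iSup_le_of_abs_le fun k => hA k ω)

/-- Jensen's inequality for a supremum: adding independent mean-zero summands to a family does not
decrease its expected supremum. -/
theorem integral_iSup_le_integral_iSup_add {Ω α β ι : Type*} [MeasurableSpace Ω]
    [MeasurableSpace α] [MeasurableSpace β] [Countable ι] [Nonempty ι]
    {μ : Measure Ω} [IsProbabilityMeasure μ] {A : Ω → α} {B : Ω → β}
    (hA : AEMeasurable A μ) (hB : AEMeasurable B μ) (hAB : IndepFun A B μ)
    {u : ι → α → ℝ} {v : ι → β → ℝ} (hu : ∀ k, Measurable (u k)) (hv : ∀ k, Measurable (v k))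
    {C C' : ℝ} (huC : ∀ k a, |u k a| ≤ C) (hvC : ∀ k b, |v k b| ≤ C')
    (hv0 : ∀ k, ∫ ω, v k (B ω) ∂μ = 0) :
    ∫ ω, ⨆ k, u k (A ω) ∂μ ≤ ∫ ω, ⨆ k, (u k (A ω) + v k (B ω)) ∂μ := by
  have := Measure.isProbabilityMeasure_map (μ := μ) hA
  have := Measure.isProbabilityMeasure_map (μ := μ) hB
  have hbound : ∀ k a b, |u k a + v k b| ≤ C + C' := fun k a b =>
    (abs_add_le _ _).trans (add_le_add (huC k a) (hvC k b))
  set F : α × β → ℝ := fun p => ⨆ k, (u k p.1 + v k p.2) with hF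
  have hFm : Measurable F :=
    Measurable.iSup fun k => ((hu k).comp measurable_fst).add ((hv k).comp measurable_snd)
  have hFint : Integrable F ((μ.map A).prod (μ.map B)) :=
    .of_bound hFm.aestronglyMeasurable (C + C')
      (.of_forall fun p => abs_iSup_le_of_abs_le fun k => hbound k p.1 p.2)
  have hright : ∫ ω, ⨆ k, (u k (A ω) + v k (B ω)) ∂μ =
      ∫ a, ∫ b, F (a, b) ∂(μ.map B) ∂(μ.map A) := by
    rw [← integral_prod _ hFint, ← hAB.map_prod_eq_prod_map_map hA hB,
      integral_map (hA.prodMk hB) hFm.aestronglyMeasurable]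
  have hum : Measurable fun a => ⨆ k, u k a := Measurable.iSup hu
  rw [hright, ← integral_map (f := fun a => ⨆ k, u k a) hA hum.aestronglyMeasurable]
  refine integral_mono (integrable_iSup_of_abs_le (fun k => (hu k).aemeasurable) huC)
    hFint.integral_prod_left fun a => ciSup_le fun k => ?_
  have hvint : Integrable (v k) (μ.map B) :=
    .of_bound (hv k).aestronglyMeasurable C' (.of_forall fun b => hvC k b)
  have hvk : ∫ b, v k b ∂(μ.map B) = 0 := by
    rw [integral_map hB (hv k).aestronglyMeasurable, hv0 k]
  calc u k a = ∫ b, (u k a + v k b) ∂(μ.map B) := by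
        rw [integral_add (integrable_const _) hvint, hvk]
        simp
    _ ≤ ∫ b, F (a, b) ∂(μ.map B) := by
        refine integral_mono ((integrable_const _).add hvint) ?_ fun b => ?_
        · exact .of_bound (hFm.comp measurable_prodMk_left).aestronglyMeasurable (C + C')
            (.of_forall fun b => abs_iSup_le_of_abs_le fun k => hbound k a b)
        · exact le_ciSup (f := fun k => u k a + v k b)
            (bddAbove_range_of_abs_le fun k => hbound k a b) k

section

variable {Ω W ι : Type*} [MeasurableSpace Ω] [MeasurableSpace W] [Countable ι] [Nonempty ι]
  {μ : Measure Ω} [IsProbabilityMeasure μ] {n : ℕ} {X : Fin n → Ω → W} {h : ι → W → ℝ} {A : ℝ}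

theorem integral_iSup_sum_subset_le (hX : ∀ i, AEMeasurable (X i) μ) (hind : iIndepFun X μ)
    (hh : ∀ k, Measurable (h k)) (hA : ∀ k w, |h k w| ≤ A)
    (h0 : ∀ k i, ∫ ω, h k (X i ω) ∂μ = 0) (S : Finset (Fin n)) :
    ∫ ω, ⨆ k, ∑ i ∈ S, h k (X i ω) ∂μ ≤
      ∫ ω, ⨆ k, (∑ i ∈ S, h k (X i ω) - ∑ i ∈ Sᶜ, h k (X i ω)) ∂μ := by
  have hAB := hind.indepFun_finset₀ S Sᶜ disjoint_compl_right hX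
  have key := integral_iSup_le_integral_iSup_add (μ := μ) (ι := ι)
    (aemeasurable_pi_lambda _ fun i : S => hX i)
    (aemeasurable_pi_lambda _ fun i : (Sᶜ : Finset (Fin n)) => hX i) hAB
    (u := fun k a => ∑ i, h k (a i)) (v := fun k b => -∑ i, h k (b i))
    (C := S.card * A) (C' := (Sᶜ : Finset (Fin n)).card * A)
    (fun k => Finset.measurable_sum _ fun i _ => (hh k).comp (measurable_pi_apply i))
    (fun k => (Finset.measurable_sum _ fun i _ => (hh k).comp (measurable_pi_apply i)).neg)
    (fun k a => by
      have := abs_sum_mul_le Finset.univ (c := fun _ => 1) (u := fun i => h k (a i))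
        (by simp) fun i _ => hA k (a i)
      simpa using this)
    (fun k b => by
      have := abs_sum_mul_le Finset.univ (c := fun _ => 1) (u := fun i => h k (b i))
        (by simp) fun i _ => hA k (b i)
      simpa using this)
    (fun k => by
      have hint : ∀ i, Integrable (fun ω => h k (X i ω)) μ := fun i =>
        .of_bound ((hh k).comp_aemeasurable (hX i)).aestronglyMeasurable A
          (.of_forall fun ω => hA k _)
      have h0' : ∫ ω, ∑ i : (Sᶜ : Finset (Fin n)), h k (X i ω) ∂μ = 0 := by
        rw [integral_finsetSum _ fun i _ => hint i.1]
        simp [h0]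
      exact (integral_neg _).trans (by rw [h0', neg_zero]))
  have hcoe : ∀ (R : Finset (Fin n)) k ω, ∑ i : R, h k (X i ω) = ∑ i ∈ R, h k (X i ω) :=
    fun R k ω => Finset.sum_coe_sort R fun i => h k (X i ω)
  simpa only [hcoe, ← sub_eq_add_neg] using key

/-- Symmetrization with a fixed sign vector, for a mean-zero class: the coordinates with sign `1` and
those with sign `-1` are treated separately, and in each part the missing coordinates are put back
with the opposite sign by Jensen's inequality. No ghost sample is needed. -/
theorem integral_iSup_sum_le_add (hX : ∀ i, AEMeasurable (X i) μ) (hind : iIndepFun X μ)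
    (hh : ∀ k, Measurable (h k)) (hA : ∀ k w, |h k w| ≤ A)
    (h0 : ∀ k i, ∫ ω, h k (X i ω) ∂μ = 0) {ξ : Fin n → ℝ} (hξ : ξ ∈ signs n) :
    ∫ ω, ⨆ k, ∑ i, h k (X i ω) ∂μ ≤
      ∫ ω, ⨆ k, ∑ i, ξ i * h k (X i ω) ∂μ + ∫ ω, ⨆ k, ∑ i, (-ξ) i * h k (X i ω) ∂μ := by
  classical
  set S : Finset (Fin n) := Finset.univ.filter fun i => ξ i = 1 with hS
  have hbound : ∀ (R : Finset (Fin n)) k ω, |∑ i ∈ R, h k (X i ω)| ≤ R.card * A :=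
    fun R k ω => by
      have := abs_sum_mul_le R (c := fun _ => 1) (u := fun i => h k (X i ω))
        (by simp) fun i _ => hA k _
      simpa using this
  have hmeas : ∀ (R : Finset (Fin n)) k, AEMeasurable (fun ω => ∑ i ∈ R, h k (X i ω)) μ :=
    fun R k => Finset.aemeasurable_fun_sum _ fun i _ => (hh k).comp_aemeasurable (hX i)
  have hint : ∀ R : Finset (Fin n), Integrable (fun ω => ⨆ k, ∑ i ∈ R, h k (X i ω)) μ :=
    fun R => integrable_iSup_of_abs_le (hmeas R) (hbound R)
  have hsplit : ∀ ω k, ∑ i, ξ i * h k (X i ω) =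
      ∑ i ∈ S, h k (X i ω) - ∑ i ∈ Sᶜ, h k (X i ω) := by
    intro ω k
    rw [← Finset.sum_add_sum_compl S, sub_eq_add_neg, ← Finset.sum_neg_distrib]
    congr 1
    · refine Finset.sum_congr rfl fun i hi => ?_
      rw [(Finset.mem_filter.1 hi).2, one_mul]
    · refine Finset.sum_congr rfl fun i hi => ?_
      have hi' : ξ i ≠ 1 := fun h => Finset.mem_compl.1 hi (by simp [hS, h])
      rw [(mem_signs.1 hξ i).resolve_right hi', neg_one_mul]
  have h1 := integral_iSup_sum_subset_le hX hind hh hA h0 S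
  have h2 := integral_iSup_sum_subset_le hX hind hh hA h0 Sᶜ
  rw [compl_compl] at h2
  have e1 : ∀ ω, ⨆ k, ∑ i, ξ i * h k (X i ω) =
      ⨆ k, (∑ i ∈ S, h k (X i ω) - ∑ i ∈ Sᶜ, h k (X i ω)) := fun ω => by simp only [hsplit]
  have e2 : ∀ ω, ⨆ k, ∑ i, (-ξ) i * h k (X i ω) =
      ⨆ k, (∑ i ∈ Sᶜ, h k (X i ω) - ∑ i ∈ S, h k (X i ω)) := fun ω => by
    simp only [Pi.neg_apply, neg_mul, Finset.sum_neg_distrib, hsplit, neg_sub]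
  simp only [e1, e2]
  refine le_trans ?_ (add_le_add h1 h2)
  rw [← integral_add (hint S) (hint Sᶜ)]
  refine integral_mono (integrable_iSup_of_abs_le (hmeas _) (hbound _))
    ((hint S).add (hint Sᶜ)) fun ω => ciSup_le fun k => ?_
  rw [← Finset.sum_add_sum_compl S]
  exact add_le_add
    (le_ciSup (f := fun k => ∑ i ∈ S, h k (X i ω))
      (bddAbove_range_of_abs_le fun k => hbound S k ω) k)
    (le_ciSup (f := fun k => ∑ i ∈ Sᶜ, h k (X i ω))
      (bddAbove_range_of_abs_le fun k => hbound Sᶜ k ω) k)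

/-- The symmetrization inequality, for a mean-zero class of products `a k * e` with a fixed bounded
multiplier `e`, in terms of the Rademacher sums of the class `a`. -/
theorem integral_iSup_sum_mul_le {a : ι → W → ℝ} {e : W → ℝ} {C : ℝ}
    (hX : ∀ i, AEMeasurable (X i) μ) (hind : iIndepFun X μ)
    (ha : ∀ k, Measurable (a k)) (haA : ∀ k w, |a k w| ≤ A)
    (he : Measurable e) (hC : 0 < C) (heC : ∀ w, |e w| ≤ C)
    (h0 : ∀ k i, ∫ ω, a k (X i ω) * e (X i ω) ∂μ = 0) :
    2 ^ n * ∫ ω, ⨆ k, ∑ i, a k (X i ω) * e (X i ω) ∂μ ≤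
      2 * C * ∑ ξ ∈ signs n, ∫ ω, ⨆ k, ∑ i, ξ i * a k (X i ω) ∂μ := by
  have hm : ∀ k, Measurable fun w => a k w * e w := fun k => (ha k).mul he
  have hA : ∀ k w, |a k w * e w| ≤ A * C := fun k w => by
    rw [abs_mul]
    exact mul_le_mul (haA k w) (heC w) (abs_nonneg _) ((abs_nonneg _).trans (haA k w))
  have hI : ∀ {b : ι → W → ℝ} {A' : ℝ}, (∀ k, Measurable (b k)) → (∀ k w, |b k w| ≤ A') →
      ∀ ξ ∈ signs n, Integrable (fun ω => ⨆ k, ∑ i, ξ i * b k (X i ω)) μ :=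
    fun hb hb' ξ hξ => integrable_iSup_of_abs_le
      (fun k => Finset.aemeasurable_fun_sum _ fun i _ =>
        ((hb k).comp_aemeasurable (hX i)).const_mul _)
      (fun k ω => abs_sum_mul_le _ (fun i _ => (abs_of_mem_signs hξ i).le) fun i _ => hb' k _)
  have hI₁ : ∀ ξ ∈ signs n,
      Integrable (fun ω => ⨆ k, ∑ i, ξ i * (a k (X i ω) * e (X i ω))) μ :=
    hI (b := fun k w => a k w * e w) hm hA
  have hI₂ := hI (b := a) ha haA
  have hcontr : ∀ ω, ∑ ξ ∈ signs n, ⨆ k, ∑ i, ξ i * (a k (X i ω) * e (X i ω)) ≤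
      C * ∑ ξ ∈ signs n, ⨆ k, ∑ i, ξ i * a k (X i ω) := fun ω =>
    sum_signs_iSup_mul_le (a := fun k i => a k (X i ω)) (e := fun i => e (X i ω))
      (fun k i => haA k (X i ω)) hC fun i => heC (X i ω)
  let s : (Fin n → ℝ) → ℝ := fun ξ => ∫ ω, ⨆ k, ∑ i, ξ i * (a k (X i ω) * e (X i ω)) ∂μ
  calc 2 ^ n * ∫ ω, ⨆ k, ∑ i, a k (X i ω) * e (X i ω) ∂μ
      = ∑ ξ ∈ signs n, ∫ ω, ⨆ k, ∑ i, a k (X i ω) * e (X i ω) ∂μ := by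
        rw [Finset.sum_const, card_signs, nsmul_eq_mul]
        simp
    _ ≤ ∑ ξ ∈ signs n, (s ξ + s (-ξ)) :=
        Finset.sum_le_sum fun ξ hξ => integral_iSup_sum_le_add hX hind hm hA h0 hξ
    _ = 2 * ∑ ξ ∈ signs n, s ξ := by
        rw [Finset.sum_add_distrib, sum_signs_neg, two_mul]
    _ = 2 * ∫ ω, ∑ ξ ∈ signs n, ⨆ k, ∑ i, ξ i * (a k (X i ω) * e (X i ω)) ∂μ := by
        rw [integral_finsetSum _ hI₁]
    _ ≤ 2 * ∫ ω, C * ∑ ξ ∈ signs n, ⨆ k, ∑ i, ξ i * a k (X i ω) ∂μ := by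
        refine mul_le_mul_of_nonneg_left ?_ zero_le_two
        exact integral_mono (integrable_finsetSum _ hI₁)
          ((integrable_finsetSum _ hI₂).const_mul C) hcontr
    _ = _ := by
        rw [integral_const_mul, integral_finsetSum _ hI₂]
        ring

end

/-! ### Empirical moments and the payoff -/

section

variable {𝒳 𝒵 E T : Type*}

/-- The empirical counterpart `ψₙ(f(·; τ); θ)` of the moment, on the first `n` observations. -/
noncomputable def sampleMoment (f : 𝒵 → T → ℝ) (g : 𝒳 → E → ℝ) (n : ℕ) (d : ℕ → Obs 𝒳 𝒵)
    (τ : T) (θ : E) : ℝ :=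
  (1 / (n : ℝ)) * ∑ i ∈ Finset.range n, f (d i).2.2 τ * ((d i).2.1 - g (d i).1 θ)

/-- The observation `w` obeys the uniform bound `B`. -/
def BoundedAt (f : 𝒵 → T → ℝ) (g : 𝒳 → E → ℝ) (Θ : Set E) (B : ℝ) (w : Obs 𝒳 𝒵) : Prop :=
  |w.2.1| ≤ B ∧ (∀ θ ∈ Θ, |g w.1 θ| ≤ B) ∧ ∀ τ : T, |f w.2.2 τ| ≤ B

variable {f : 𝒵 → T → ℝ} {g : 𝒳 → E → ℝ} {Θ : Set E} {B : ℝ}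

theorem BoundedAt.abs_sub_le {w : Obs 𝒳 𝒵} (hw : BoundedAt f g Θ B w) {θ : E} (hθ : θ ∈ Θ) :
    |w.2.1 - g w.1 θ| ≤ 2 * B := by
  have h1 := abs_le.1 hw.1
  have h2 := abs_le.1 (hw.2.1 θ hθ)
  rw [abs_le]
  constructor <;> linarith

theorem BoundedAt.abs_mul_le {w : Obs 𝒳 𝒵} (hw : BoundedAt f g Θ B w) (τ : T) {θ : E}
    (hθ : θ ∈ Θ) : |f w.2.2 τ * (w.2.1 - g w.1 θ)| ≤ 2 * B ^ 2 := by
  rw [abs_mul]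
  calc _ ≤ B * (2 * B) :=
        mul_le_mul (hw.2.2 τ) (hw.abs_sub_le hθ) (abs_nonneg _)
          ((abs_nonneg _).trans (hw.2.2 τ))
    _ = 2 * B ^ 2 := by ring

theorem abs_mean_le {n : ℕ} {x : ℕ → ℝ} {A : ℝ} (hA : 0 ≤ A) (hx : ∀ i, |x i| ≤ A) :
    |(1 / (n : ℝ)) * ∑ i ∈ Finset.range n, x i| ≤ A := by
  have h := abs_sum_mul_le (Finset.range n) (c := fun _ => 1) (u := x) (by simp)
    fun i _ => hx i
  simp only [one_mul, Finset.card_range] at h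
  rcases Nat.eq_zero_or_pos n with rfl | hn
  · simpa using hA
  · have hn' : (0 : ℝ) < n := by exact_mod_cast hn
    rw [abs_mul, abs_of_pos (by positivity)]
    rw [one_div, inv_mul_le_iff₀ hn']
    exact h

theorem abs_sampleMoment_le {d : ℕ → Obs 𝒳 𝒵} (hd : ∀ i, BoundedAt f g Θ B (d i)) (n : ℕ)
    (τ : T) {θ : E} (hθ : θ ∈ Θ) : |sampleMoment f g n d τ θ| ≤ 2 * B ^ 2 :=
  abs_mean_le (by positivity) fun i => (hd i).abs_mul_le τ hθ

theorem payoff_eq (n : ℕ) (d : ℕ → Obs 𝒳 𝒵) (θ' θ : E) (τ : T) :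
    payoff f g n d θ' θ τ = sampleMoment f g n d τ θ -
      1 / 4 * ((1 / (n : ℝ)) *
        ∑ i ∈ Finset.range n, (f (d i).2.2 τ) ^ 2 * ((d i).2.1 - g (d i).1 θ') ^ 2) := by
  rw [payoff, sampleMoment, ← mul_assoc, ← one_div_mul_one_div]

theorem payoff_le_sampleMoment (n : ℕ) (d : ℕ → Obs 𝒳 𝒵) (θ' θ : E) (τ : T) :
    payoff f g n d θ' θ τ ≤ sampleMoment f g n d τ θ := by
  rw [payoff_eq]
  exact sub_le_self _ (by positivity)

/-- The quadratic penalty of the payoff is at most `B⁴` for bounded data. -/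
theorem sampleMoment_sub_le_payoff {d : ℕ → Obs 𝒳 𝒵} (hd : ∀ i, BoundedAt f g Θ B (d i)) (n : ℕ)
    {θ' : E} (hθ' : θ' ∈ Θ) (θ : E) {τ τ' : T} {c : ℝ} (hτ : ∀ z, f z τ' = c * f z τ) :
    c * sampleMoment f g n d τ θ - c ^ 2 * B ^ 4 ≤ payoff f g n d θ' θ τ' := by
  have hq := (abs_le.1 (abs_mean_le (n := n) (A := 4 * B ^ 4)
    (x := fun i => (f (d i).2.2 τ) ^ 2 * ((d i).2.1 - g (d i).1 θ') ^ 2) (by positivity)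
    fun i => by
      rw [← mul_pow, abs_pow]
      calc _ ≤ (2 * B ^ 2) ^ 2 := pow_le_pow_left₀ (abs_nonneg _) ((hd i).abs_mul_le τ hθ') 2
        _ = 4 * B ^ 4 := by ring)).2
  have h1 : sampleMoment f g n d τ' θ = c * sampleMoment f g n d τ θ := by
    simp only [sampleMoment, hτ, Finset.mul_sum]
    refine Finset.sum_congr rfl fun i _ => ?_
    ring
  have h2 : ∑ i ∈ Finset.range n, (f (d i).2.2 τ') ^ 2 * ((d i).2.1 - g (d i).1 θ') ^ 2 =
      c ^ 2 * ∑ i ∈ Finset.range n, (f (d i).2.2 τ) ^ 2 * ((d i).2.1 - g (d i).1 θ') ^ 2 := by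
    simp only [hτ, Finset.mul_sum]
    refine Finset.sum_congr rfl fun i _ => ?_
    ring
  rw [payoff_eq, h1, h2]
  nlinarith [mul_le_mul_of_nonneg_left hq (sq_nonneg c)]

theorem abs_payoff_le {d : ℕ → Obs 𝒳 𝒵} (hd : ∀ i, BoundedAt f g Θ B (d i)) (n : ℕ)
    {θ' θ : E} (hθ' : θ' ∈ Θ) (hθ : θ ∈ Θ) (τ : T) :
    |payoff f g n d θ' θ τ| ≤ 2 * B ^ 2 + B ^ 4 := by
  have h1 := abs_le.1 (abs_sampleMoment_le hd n τ hθ)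
  have h2 := payoff_le_sampleMoment (f := f) (g := g) n d θ' θ τ
  have h3 := sampleMoment_sub_le_payoff hd n hθ' θ (τ := τ) (τ' := τ) (c := 1) (by simp)
  have h4 : 0 ≤ B ^ 4 := by positivity
  rw [abs_le]
  constructor <;> linarith

/-- In an approximate equilibrium with errors `r` and `s`, the minimizing player could have chosen
`θ₀` and the maximizing player the function `c f(·; τ)`. -/
theorem le_of_approxEquilibrium {d : ℕ → Obs 𝒳 𝒵} (hd : ∀ i, BoundedAt f g Θ B (d i)) {n : ℕ}
    (hstar : AbsolutelyStarShaped f) {θ₀ θ' θ : E} (hθ₀ : θ₀ ∈ Θ) (hθ' : θ' ∈ Θ) (hθ : θ ∈ Θ)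
    {τ' : T} {r s : ℝ}
    (hr : (⨆ τ : T, payoff f g n d θ' θ τ) - r ≤ payoff f g n d θ' θ τ')
    (hs : payoff f g n d θ' θ τ' ≤ (⨅ θ : Θ, payoff f g n d θ' θ τ') + s)
    (τ : T) {c : ℝ} (hc : |c| ≤ 1) :
    c * sampleMoment f g n d τ θ - c ^ 2 * B ^ 4 ≤
      (⨆ τ, sampleMoment f g n d τ θ₀) + r + s := by
  obtain ⟨σ, hσ⟩ := hstar τ c hc
  have h1 := sampleMoment_sub_le_payoff hd n hθ' θ hσ
  have h2 : payoff f g n d θ' θ σ ≤ ⨆ τ : T, payoff f g n d θ' θ τ :=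
    le_ciSup (bddAbove_range_of_abs_le fun τ => abs_payoff_le hd n hθ' hθ τ) σ
  have h3 : (⨅ θ : Θ, payoff f g n d θ' θ τ') ≤ payoff f g n d θ' θ₀ τ' := by
    refine ciInf_le (f := fun θ : Θ => payoff f g n d θ' θ τ') ?_ ⟨θ₀, hθ₀⟩
    refine ⟨-(2 * B ^ 2 + B ^ 4), ?_⟩
    rintro _ ⟨θ, rfl⟩
    exact (abs_le.1 (abs_payoff_le hd n hθ' θ.2 τ')).1
  have h4 := payoff_le_sampleMoment (f := f) (g := g) n d θ' θ₀ τ'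
  have h5 : sampleMoment f g n d τ' θ₀ ≤ ⨆ τ, sampleMoment f g n d τ θ₀ :=
    le_ciSup (bddAbove_range_of_abs_le fun τ => abs_sampleMoment_le hd n τ hθ₀) τ'
  linarith

end

/-! ### Moments at the true parameter -/

section

variable {Ω 𝒳 𝒵 E T : Type*} [MeasurableSpace Ω] [MeasurableSpace 𝒳] [MeasurableSpace 𝒵]
  {P : Measure (Obs 𝒳 𝒵)} {f : 𝒵 → T → ℝ} {g : 𝒳 → E → ℝ}
  {Θ : Set E} {B : ℝ}

theorem measurable_residual {θ : E} (hg : Measurable fun x => g x θ) :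
    Measurable fun w : Obs 𝒳 𝒵 => w.2.1 - g w.1 θ :=
  measurable_snd.fst.sub (hg.comp measurable_fst)

theorem measurable_moment_integrand {τ : T} {θ : E} (hf : Measurable fun z => f z τ)
    (hg : Measurable fun x => g x θ) :
    Measurable fun w : Obs 𝒳 𝒵 => f w.2.2 τ * (w.2.1 - g w.1 θ) :=
  (hf.comp measurable_snd.snd).mul (measurable_residual hg)

/-- A variable with conditional mean zero is orthogonal to every bounded function measurable with
respect to the conditioning σ-algebra. -/
theorem integral_mul_eq_zero_of_condExp {α : Type*} {m m₀ : MeasurableSpace α} (hm : m ≤ m₀)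
    {ν : Measure α} [IsFiniteMeasure ν] {u e : α → ℝ} {C : ℝ} (hu : StronglyMeasurable[m] u)
    (huC : ∀ᵐ x ∂ν, ‖u x‖ ≤ C) (he : Integrable e ν) (h0 : ν[e | m] =ᵐ[ν] fun _ => (0 : ℝ)) :
    ∫ x, u x * e x ∂ν = 0 := by
  have hzero : ν[u * e | m] =ᵐ[ν] 0 := by
    filter_upwards [condExp_stronglyMeasurable_mul_of_bound hm hu he C huC, h0] with w h1 h2
    rw [h1, Pi.mul_apply, h2, mul_zero, Pi.zero_apply]
  calc ∫ x, u x * e x ∂ν = ∫ x, (ν[u * e | m]) x ∂ν := (integral_condExp hm).symm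
    _ = 0 := by
        rw [integral_congr_ae hzero]
        simp

theorem moment_eq_zero_of_IVModel [IsProbabilityMeasure P] {θ₀ : E} (hθ₀ : θ₀ ∈ Θ)
    (hg : Measurable fun x => g x θ₀) (hB : ∀ᵐ w ∂P, BoundedAt f g Θ B w)
    (hmodel : IVModel P g θ₀) {τ : T} (hf : Measurable fun z => f z τ) :
    moment P f g τ θ₀ = 0 := by
  refine integral_mul_eq_zero_of_condExp (C := B) (Measurable.comap_le measurable_snd.snd)
    (hf.comp (comap_measurable _)).stronglyMeasurable ?_ ?_ hmodel
  · filter_upwards [hB] with w hw using hw.2.2 τ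
  · refine .of_bound (measurable_residual hg).aestronglyMeasurable (2 * B) ?_
    filter_upwards [hB] with w hw using hw.abs_sub_le hθ₀

variable {μ : Measure Ω} {D : ℕ → Ω → Obs 𝒳 𝒵}

theorem ae_forall_sample (hD : ∀ i, HasLaw (D i) P μ) {p : Obs 𝒳 𝒵 → Prop}
    (hp : ∀ᵐ w ∂P, p w) : ∀ᵐ ω ∂μ, ∀ i, p (D i ω) := by
  refine ae_all_iff.2 fun i => ?_
  refine ae_of_ae_map (hD i).aemeasurable ?_
  rwa [(hD i).map_eq]

theorem integral_comp_sample (hD : ∀ i, HasLaw (D i) P μ) {h : Obs 𝒳 𝒵 → ℝ} (hh : Measurable h)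
    (i : ℕ) : ∫ ω, h (D i ω) ∂μ = ∫ w, h w ∂P := by
  rw [← (hD i).map_eq, integral_map (hD i).aemeasurable hh.aestronglyMeasurable]

variable [IsProbabilityMeasure P] [IsProbabilityMeasure μ]
  [TopologicalSpace T] [TopologicalSpace.SeparableSpace T]

/-- The expected supremum of the empirical moments at the true parameter is bounded by the
Rademacher complexity of the class of `f`. -/
theorem integral_iSup_sampleMoment_le [Nonempty T] (hD : ∀ i, HasLaw (D i) P μ)
    (hind : iIndepFun D μ) (hf_meas : ∀ τ, Measurable fun z => f z τ)
    (hf_cont : ∀ z, Continuous fun τ => f z τ) {θ₀ : E} (hθ₀ : θ₀ ∈ Θ)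
    (hg : Measurable fun x => g x θ₀) (hB0 : 0 < B) (hB : ∀ᵐ w ∂P, BoundedAt f g Θ B w)
    (hmodel : IVModel P g θ₀) (n : ℕ) :
    Integrable (fun ω => ⨆ τ, sampleMoment f g n (fun i => D i ω) τ θ₀) μ ∧
      ∫ ω, ⨆ τ, sampleMoment f g n (fun i => D i ω) τ θ₀ ∂μ ≤
        4 * B * rademacher μ (fun i ω => (D i ω).2.2) f n := by
  set u := TopologicalSpace.denseSeq T
  have hu : DenseRange u := TopologicalSpace.denseRange_denseSeq T
  -- The observations satisfying the bounds along the dense sequence form a measurable set of full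
  -- measure; off it, the functions are truncated to zero so that the bounds hold everywhere.
  set G : Set (Obs 𝒳 𝒵) := {w | |w.2.1 - g w.1 θ₀| ≤ 2 * B ∧ ∀ k, |f w.2.2 (u k)| ≤ B} with hG
  have hfm : ∀ k, Measurable fun w : Obs 𝒳 𝒵 => f w.2.2 (u k) := fun k =>
    (hf_meas (u k)).comp measurable_snd.snd
  have hGm : MeasurableSet G := by
    have h1 : MeasurableSet {w : Obs 𝒳 𝒵 | |w.2.1 - g w.1 θ₀| ≤ 2 * B} :=
      measurableSet_le (measurable_residual hg).abs measurable_const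
    have h2 : MeasurableSet {w : Obs 𝒳 𝒵 | ∀ k, |f w.2.2 (u k)| ≤ B} := by
      rw [Set.ofPred_forall]
      exact MeasurableSet.iInter fun k => measurableSet_le (hfm k).abs measurable_const
    exact h1.inter h2
  have hGae : ∀ᵐ w ∂P, w ∈ G := by
    filter_upwards [hB] with w hw using ⟨hw.abs_sub_le hθ₀, fun k => hw.2.2 (u k)⟩
  set a : ℕ → Obs 𝒳 𝒵 → ℝ := fun k => G.indicator fun w => f w.2.2 (u k) with ha
  set e : Obs 𝒳 𝒵 → ℝ := G.indicator fun w => w.2.1 - g w.1 θ₀ with he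
  have ham : ∀ k, Measurable (a k) := fun k => (hfm k).indicator hGm
  have hem : Measurable e := (measurable_residual hg).indicator hGm
  have haB : ∀ k w, |a k w| ≤ B := fun k w => by
    by_cases hw : w ∈ G
    · simpa [ha, hw] using hw.2 k
    · simpa [ha, hw] using hB0.le
  have heB : ∀ w, |e w| ≤ 2 * B := fun w => by
    by_cases hw : w ∈ G
    · simpa [he, hw] using hw.1
    · simpa [he, hw] using hB0.le
  have h0 : ∀ k (i : Fin n), ∫ ω, a k (D i ω) * e (D i ω) ∂μ = 0 := fun k i => by
    rw [integral_comp_sample hD (h := fun w => a k w * e w) ((ham k).mul hem),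
      ← moment_eq_zero_of_IVModel hθ₀ hg hB hmodel (hf_meas (u k)), moment]
    refine integral_congr_ae ?_
    filter_upwards [hGae] with w hw
    simp [ha, he, hw]
  have hind' : iIndepFun (fun i : Fin n => D i) μ := hind.precomp Fin.val_injective
  have key := integral_iSup_sum_mul_le (n := n) (X := fun i : Fin n => D i)
    (fun i => (hD i).aemeasurable) hind' ham haB hem (C := 2 * B) (by positivity) heB h0
  have hS : (fun ω => ⨆ τ, sampleMoment f g n (fun i => D i ω) τ θ₀) =ᵐ[μ] fun ω =>
      (1 / (n : ℝ)) * ⨆ k, ∑ i : Fin n, a k (D i ω) * e (D i ω) := by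
    filter_upwards [ae_forall_sample hD hGae] with ω hω
    have hc : Continuous fun τ => sampleMoment f g n (fun i => D i ω) τ θ₀ :=
      continuous_const.mul (continuous_finsetSum _ fun i _ => (hf_cont _).mul continuous_const)
    rw [← iSup_denseRange_eq hc hu, Real.mul_iSup_of_nonneg (by positivity)]
    refine iSup_congr fun k => ?_
    simp only [sampleMoment, ha, he, Set.indicator_of_mem (hω _), Finset.sum_range]
  have hR : ∀ ξ : Fin n → ℝ,
      ∫ ω, (⨆ τ, (1 / (n : ℝ)) * ∑ i : Fin n, ξ i * f (D i ω).2.2 τ) ∂μ =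
        (1 / (n : ℝ)) * ∫ ω, ⨆ k, ∑ i : Fin n, ξ i * a k (D i ω) ∂μ := by
    intro ξ
    rw [← integral_const_mul]
    refine integral_congr_ae ?_
    filter_upwards [ae_forall_sample hD hGae] with ω hω
    have hc : Continuous fun τ => (1 / (n : ℝ)) * ∑ i : Fin n, ξ i * f (D i ω).2.2 τ :=
      continuous_const.mul (continuous_finsetSum _ fun i _ => continuous_const.mul (hf_cont _))
    rw [← iSup_denseRange_eq hc hu, Real.mul_iSup_of_nonneg (by positivity)]
    refine iSup_congr fun k => ?_
    simp only [ha, Set.indicator_of_mem (hω _)]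
  constructor
  · refine Integrable.congr (Integrable.const_mul ?_ _) hS.symm
    refine integrable_iSup_of_abs_le (A := n * (B * (2 * B))) (fun k => ?_) fun k ω => ?_
    · exact Finset.aemeasurable_fun_sum _ fun i _ =>
        ((ham k).mul hem).comp_aemeasurable (hD i).aemeasurable
    · have := abs_sum_mul_le Finset.univ (c := fun _ => 1) (A := B * (2 * B))
        (u := fun i : Fin n => a k (D i ω) * e (D i ω)) (by simp) fun i _ => by
          rw [abs_mul]
          exact mul_le_mul (haB _ _) (heB _) (abs_nonneg _) hB0.le
      simpa using this
  · rw [integral_congr_ae hS, integral_const_mul, rademacher]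
    simp only [hR]
    rw [← Finset.mul_sum]
    have hn : (0 : ℝ) ≤ 1 / n := by positivity
    have h2 : (0 : ℝ) < 2 ^ n := by positivity
    have key' := mul_le_mul_of_nonneg_left key (mul_nonneg hn (inv_nonneg.2 h2.le))
    calc _ = (1 / (n : ℝ)) * (2 ^ n)⁻¹ *
          (2 ^ n * ∫ ω, ⨆ k, ∑ i : Fin n, a k (D i ω) * e (D i ω) ∂μ) := by
          field_simp
      _ ≤ _ := key'
      _ = _ := by
          rw [signs]
          ring

/-- `sup_τ ψₙ(f(·; τ); θ₀) = o_p(1)`. -/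
theorem tendstoInMeasure_iSup_sampleMoment [Nonempty T] (hD : ∀ i, HasLaw (D i) P μ)
    (hind : iIndepFun D μ) (hf_meas : ∀ τ, Measurable fun z => f z τ)
    (hf_cont : ∀ z, Continuous fun τ => f z τ) {θ₀ : E} (hθ₀ : θ₀ ∈ Θ)
    (hg : Measurable fun x => g x θ₀) (hB0 : 0 < B) (hB : ∀ᵐ w ∂P, BoundedAt f g Θ B w)
    (hmodel : IVModel P g θ₀) (hstar : AbsolutelyStarShaped f)
    (hcomplexity : Tendsto (rademacher μ (fun i ω => (D i ω).2.2) f) atTop (𝓝 0)) :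
    IsLittleOp μ fun n ω => ⨆ τ, sampleMoment f g n (fun i => D i ω) τ θ₀ := by
  have hbd := integral_iSup_sampleMoment_le hD hind hf_meas hf_cont hθ₀ hg hB0 hB hmodel
  -- The class contains the zero function, so the supremum is nonnegative.
  have hnn : ∀ n ω, 0 ≤ ⨆ τ, sampleMoment f g n (fun i => D i ω) τ θ₀ := fun n ω => by
    obtain ⟨σ, hσ⟩ := hstar (Classical.arbitrary T) 0 (by simp)
    exact Real.iSup_nonneg' ⟨σ, by simp [sampleMoment, hσ]⟩
  refine tendstoInMeasure_iff_measureReal_norm.2 fun ε hε => ?_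
  have hlim := (hcomplexity.const_mul (4 * B)).div_const ε
  rw [mul_zero, zero_div] at hlim
  refine squeeze_zero (fun n => measureReal_nonneg) (fun n => ?_) hlim
  rw [le_div_iff₀' hε]
  refine le_trans ?_ (hbd n).2
  have hmarkov := mul_meas_ge_le_integral_of_nonneg (.of_forall (hnn n)) (hbd n).1 ε
  simpa [abs_of_nonneg (hnn n _)] using hmarkov

end

/-! ### Empirical moments away from the identified set -/

/-- Local lower envelopes: for a bounded family `h`, continuous in its parameter, the infimum over a
small ball around `θ` is a measurable function whose integral is close to that of `h θ`. -/
theorem exists_lower_envelope {M W : Type*} [PseudoMetricSpace M] [SecondCountableTopology M]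
    [MeasurableSpace W] {P : Measure W} [IsFiniteMeasure P] {h : M → W → ℝ}
    (hm : ∀ θ, Measurable (h θ)) {C : ℝ}
    (hC : ∀ᵐ w ∂P, (∀ θ, |h θ w| ≤ C) ∧ Continuous fun θ => h θ w) (θ : M) {c : ℝ}
    (hc : c < ∫ w, h θ w ∂P) :
    ∃ r > 0, ∃ m : W → ℝ, Measurable m ∧ Integrable m P ∧
      (∀ᵐ w ∂P, ∀ θ' ∈ Metric.ball θ r, m w ≤ h θ' w) ∧ c < ∫ w, m w ∂P := by
  have hr : ∀ j : ℕ, (0 : ℝ) < 1 / (j + 1) := fun j => by positivity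
  have hne : ∀ j : ℕ, Nonempty (Metric.ball θ (1 / ((j : ℝ) + 1))) := fun j =>
    ⟨⟨θ, Metric.mem_ball_self (hr j)⟩⟩
  let u : (j : ℕ) → ℕ → Metric.ball θ (1 / ((j : ℝ) + 1)) := fun j =>
    TopologicalSpace.denseSeq _
  let m : ℕ → W → ℝ := fun j w => ⨅ k, h (u j k) w
  have hmm : ∀ j, Measurable (m j) := fun j => Measurable.iInf fun k => hm _
  have hmC : ∀ j, ∀ᵐ w ∂P, ‖m j w‖ ≤ C := fun j => by
    filter_upwards [hC] with w hw
    have hb : BddBelow (Set.range fun k => h (u j k) w) := by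
      refine ⟨-C, ?_⟩
      rintro _ ⟨k, rfl⟩
      exact (abs_le.1 (hw.1 _)).1
    exact abs_le.2 ⟨le_ciInf fun k => (abs_le.1 (hw.1 _)).1,
      (ciInf_le hb 0).trans (abs_le.1 (hw.1 _)).2⟩
  have hle : ∀ j : ℕ, ∀ᵐ w ∂P, ∀ θ' ∈ Metric.ball θ (1 / ((j : ℝ) + 1)), m j w ≤ h θ' w := by
    intro j
    filter_upwards [hC] with w hw θ' hθ'
    have hb : BddBelow (Set.range fun k => h (u j k) w) := by
      refine ⟨-C, ?_⟩
      rintro _ ⟨k, rfl⟩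
      exact (abs_le.1 (hw.1 _)).1
    exact (TopologicalSpace.denseRange_denseSeq _).induction_on
      (p := fun v : Metric.ball θ (1 / ((j : ℝ) + 1)) => m j w ≤ h v w) ⟨θ', hθ'⟩
      (isClosed_le continuous_const (hw.2.comp continuous_subtype_val)) fun k => ciInf_le hb k
  have hlim : ∀ᵐ w ∂P, Tendsto (fun j => m j w) atTop (𝓝 (h θ w)) := by
    filter_upwards [hC, ae_all_iff.2 hle] with w hw hlew
    refine Metric.tendsto_atTop.2 fun η hη => ?_
    obtain ⟨δ, hδ, hδη⟩ := Metric.continuousAt_iff.1 (hw.2.continuousAt (x := θ)) (η / 2)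
      (by positivity)
    obtain ⟨N, hN⟩ := exists_nat_one_div_lt hδ
    refine ⟨N, fun j hj => ?_⟩
    have hjδ : 1 / ((j : ℝ) + 1) < δ := (Nat.one_div_le_one_div hj).trans_lt hN
    have h1 := hlew j θ (Metric.mem_ball_self (hr j))
    have h2 : h θ w - η / 2 ≤ m j w := le_ciInf fun k => by
      have := hδη ((Metric.mem_ball.1 (u j k).2).trans hjδ)
      rw [Real.dist_eq] at this
      linarith [(abs_lt.1 this).1]
    rw [Real.dist_eq, abs_lt]
    constructor <;> linarith
  have hint : Tendsto (fun j => ∫ w, m j w ∂P) atTop (𝓝 (∫ w, h θ w ∂P)) :=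
    tendsto_integral_of_dominated_convergence (fun _ => C)
      (fun j => (hmm j).aestronglyMeasurable) (integrable_const C) hmC hlim
  obtain ⟨j, hj⟩ := (hint.eventually (lt_mem_nhds hc)).exists
  exact ⟨_, hr j, m j, hmm j, .of_bound (hmm j).aestronglyMeasurable C (hmC j), hle j, hj⟩

section

variable {Ω 𝒳 𝒵 E T : Type*} [MeasurableSpace Ω] [MeasurableSpace 𝒳] [MeasurableSpace 𝒵]
  {P : Measure (Obs 𝒳 𝒵)} {f : 𝒵 → T → ℝ} {g : 𝒳 → E → ℝ}
  {Θ : Set E} {B : ℝ} {μ : Measure Ω} [IsProbabilityMeasure μ] {D : ℕ → Ω → Obs 𝒳 𝒵}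

/-- The weak law of large numbers for a function of the observations. -/
theorem tendstoInMeasure_mean (hD : ∀ i, HasLaw (D i) P μ) (hind : iIndepFun D μ)
    {m : Obs 𝒳 𝒵 → ℝ} (hm : Measurable m) (hint : Integrable m P) :
    TendstoInMeasure μ (fun n ω => (∑ i ∈ Finset.range n, m (D i ω)) / (n : ℝ)) atTop
      (fun _ => ∫ w, m w ∂P) := by
  have hid : ∀ i, IdentDistrib (D i) (D 0) μ μ := fun i =>
    ⟨(hD i).aemeasurable, (hD 0).aemeasurable, by rw [(hD i).map_eq, (hD 0).map_eq]⟩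
  have hae := fun i => hm.comp_aemeasurable (hD i).aemeasurable
  have hslln := strong_law_ae_real (μ := μ) (fun i ω => m (D i ω))
    (by
      have := (hD 0).map_eq ▸ hint
      exact this.comp_aemeasurable (hD 0).aemeasurable)
    (fun i j hij => (hind.indepFun hij).comp hm hm) (fun i => (hid i).comp hm)
  rw [integral_comp_sample hD hm] at hslln
  exact tendstoInMeasure_of_tendsto_ae
    (fun n => ((Finset.aemeasurable_fun_sum _ fun i _ => hae i).div_const _).aestronglyMeasurable)
    hslln

/-- Outside the identified set some moment is positive, because the class of `f` is symmetric. -/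
theorem exists_moment_pos (hstar : AbsolutelyStarShaped f) {θ : E} (hθ : θ ∈ Θ)
    (hθ' : θ ∉ identifiedSet P f g Θ) : ∃ τ, 0 < moment P f g τ θ := by
  have : ∃ τ, moment P f g τ θ ≠ 0 := by
    by_contra! h
    exact hθ' ⟨hθ, h⟩
  obtain ⟨τ, hτ⟩ := this
  rcases lt_or_gt_of_ne hτ with h | h
  · obtain ⟨σ, hσ⟩ := hstar τ (-1) (by simp)
    refine ⟨σ, ?_⟩
    have : moment P f g σ θ = -moment P f g τ θ := by
      simp only [moment, hσ, ← integral_neg]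
      refine integral_congr_ae (.of_forall fun w => ?_)
      ring
    linarith
  · exact ⟨τ, h⟩

variable [IsProbabilityMeasure P] [NormedAddCommGroup E]

/-- On a compact set of parameters that are not identified, with probability tending to one every
parameter violates some empirical moment condition by a fixed amount. -/
theorem exists_tendsto_measure_sampleMoment (hD : ∀ i, HasLaw (D i) P μ) (hind : iIndepFun D μ)
    (hΘ : IsCompact Θ) (hf_meas : ∀ τ, Measurable fun z => f z τ)
    (hg_meas : ∀ θ ∈ Θ, Measurable fun x => g x θ)
    (hg_cont : ∀ x, ContinuousOn (fun θ => g x θ) Θ) (hstar : AbsolutelyStarShaped f)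
    (hB : ∀ᵐ w ∂P, BoundedAt f g Θ B w) {K : Set E} (hK : IsCompact K) (hKΘ : K ⊆ Θ)
    (hKid : Disjoint K (identifiedSet P f g Θ)) :
    ∃ c > 0, Tendsto (fun n =>
      μ {ω | ¬ ∀ θ ∈ K, ∃ τ, c < sampleMoment f g n (fun i => D i ω) τ θ}) atTop (𝓝 0) := by
  have := isCompact_iff_compactSpace.1 hΘ
  have : SecondCountableTopology Θ := EMetric.secondCountable_of_sigmaCompact Θ
  refine hK.induction_on (p := fun S => ∃ c > 0, Tendsto (fun n =>
    μ {ω | ¬ ∀ θ ∈ S, ∃ τ, c < sampleMoment f g n (fun i => D i ω) τ θ}) atTop (𝓝 0))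
    ?_ ?_ ?_ ?_
  · exact ⟨1, one_pos, by simp⟩
  · rintro S S' hSS' ⟨c, hc, hlim⟩
    refine ⟨c, hc, tendsto_of_tendsto_of_tendsto_of_le_of_le tendsto_const_nhds hlim
      (fun _ => zero_le) fun n => measure_mono fun ω hω h => hω fun θ hθ => h θ (hSS' hθ)⟩
  · rintro S S' ⟨c, hc, hlim⟩ ⟨c', hc', hlim'⟩
    have hsum := hlim.add hlim'
    rw [add_zero] at hsum
    refine ⟨min c c', lt_min hc hc', tendsto_of_tendsto_of_tendsto_of_le_of_le
      tendsto_const_nhds hsum (fun _ => zero_le)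
      fun n => (measure_mono fun ω hω => ?_).trans (measure_union_le _ _)⟩
    by_contra hcon
    rw [Set.mem_union, not_or] at hcon
    refine hω fun θ hθ => ?_
    rcases hθ with hθ | hθ
    · obtain ⟨τ, hτ⟩ := not_not.1 hcon.1 θ hθ
      exact ⟨τ, (min_le_left _ _).trans_lt hτ⟩
    · obtain ⟨τ, hτ⟩ := not_not.1 hcon.2 θ hθ
      exact ⟨τ, (min_le_right _ _).trans_lt hτ⟩
  · intro θ hθ
    obtain ⟨τ, hτ⟩ := exists_moment_pos hstar (hKΘ hθ)
      fun h => Set.disjoint_left.1 hKid hθ h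
    -- Near `θ` the empirical moments dominate the sample mean of a lower envelope `m`; since `m` is
    -- measurable, the exceptional event is covered by one to which the law of large numbers applies.
    obtain ⟨r, hr, m, hm, hmint, hle, hlt⟩ := exists_lower_envelope (M := Θ) (P := P)
      (h := fun θ w => f w.2.2 τ * (w.2.1 - g w.1 θ)) (C := 2 * B ^ 2)
      (fun θ => measurable_moment_integrand (hf_meas τ) (hg_meas θ θ.2))
      (by
        filter_upwards [hB] with w hw
        exact ⟨fun θ => hw.abs_mul_le τ θ.2, continuous_const.mul
          (continuous_const.sub (continuousOn_iff_continuous_domRestrict.1 (hg_cont w.1)))⟩)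
      ⟨θ, hKΘ hθ⟩ (half_lt_self hτ)
    change moment P f g τ θ / 2 < _ at hlt
    refine ⟨K ∩ Metric.ball θ r, inter_mem_nhdsWithin _ (Metric.ball_mem_nhds θ hr),
      moment P f g τ θ / 2, half_pos hτ, ?_⟩
    refine tendsto_of_tendsto_of_tendsto_of_le_of_le tendsto_const_nhds
      (tendstoInMeasure_iff_dist.1 (tendstoInMeasure_mean hD hind hm hmint) _ (sub_pos.2 hlt))
      (fun _ => zero_le) fun n => measure_mono_ae ?_
    filter_upwards [ae_forall_sample hD hle] with ω hω hbad
    by_contra hcon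
    refine hbad fun θ' hθ' => ⟨τ, ?_⟩
    have hclose := (abs_lt.1 (Real.dist_eq _ _ ▸ not_le.1 hcon)).1
    have havg : (∑ i ∈ Finset.range n, m (D i ω)) / (n : ℝ) ≤
        sampleMoment f g n (fun i => D i ω) τ θ' := by
      rw [sampleMoment, div_eq_inv_mul, one_div]
      exact mul_le_mul_of_nonneg_left
        (Finset.sum_le_sum fun i _ => hω i ⟨θ', hKΘ hθ'.1⟩ hθ'.2) (by positivity)
    linarith

end

end DeepGMM

/-! ### Consistency of the approximate equilibrium -/

open DeepGMM

theorem lemma2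
    {Ω 𝒳 𝒵 E T : Type*}
    [MeasurableSpace Ω] [MeasurableSpace 𝒳] [MeasurableSpace 𝒵]
    [NormedAddCommGroup E] [NormedSpace ℝ E]
    [TopologicalSpace T] [TopologicalSpace.SeparableSpace T]
    (μ : Measure Ω) [IsProbabilityMeasure μ]
    -- the law of `(X, Y, Z)` and an i.i.d. sample from it
    (P : Measure (DeepGMM.Obs 𝒳 𝒵)) [IsProbabilityMeasure P]
    (D : ℕ → Ω → DeepGMM.Obs 𝒳 𝒵)
    (hD_law : ∀ i, HasLaw (D i) P μ)
    (hD_indep : iIndepFun D μ)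
    -- the two parametrized function classes
    (Θ : Set E) (hΘ : IsCompact Θ)
    (f : 𝒵 → T → ℝ) (g : 𝒳 → E → ℝ)
    (hf_meas : ∀ τ, Measurable (fun z => f z τ))
    (hg_meas : ∀ θ ∈ Θ, Measurable (fun x => g x θ))
    -- the instrumental variable model, with the true response in the class
    (θ₀ : E) (hθ₀ : θ₀ ∈ Θ)
    (hmodel : DeepGMM.IVModel P g θ₀)
    -- bounded complexity
    (hcomplexity_f :
      Tendsto (DeepGMM.rademacher μ (fun i ω => (D i ω).2.2) f) atTop (𝓝 0))
    (hcomplexity_g :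
      Tendsto (DeepGMM.rademacher μ (fun i ω => (D i ω).1) (fun x (θ : Θ) => g x θ))
        atTop (𝓝 0))
    -- absolutely star shaped
    (hstar : DeepGMM.AbsolutelyStarShaped f)
    -- continuity
    (hg_cont : ∀ x, ContinuousOn (fun θ => g x θ) Θ)
    (hf_cont : ∀ z, Continuous (fun τ => f z τ))
    -- boundedness
    (hbdd : DeepGMM.BoundedClasses P f g Θ)
    -- identification of `g`
    (hident : ∀ θ₁ ∈ DeepGMM.identifiedSet P f g Θ, ∀ θ₂ ∈ DeepGMM.identifiedSet P f g Θ,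
      ∀ x, g x θ₁ = g x θ₂)
    -- an approximate equilibrium of the game
    (θtilde θhat : ℕ → Ω → E) (τhat : ℕ → Ω → T)
    (hθtilde : ∀ n ω, θtilde n ω ∈ Θ) (hθhat : ∀ n ω, θhat n ω ∈ Θ)
    (heq : DeepGMM.IsApproxEquilibrium μ D f g Θ θtilde θhat τhat) :
    TendstoInMeasure μ
      (fun n ω => ⨅ θ : DeepGMM.identifiedSet P f g Θ, ‖θhat n ω - (θ : E)‖)
      atTop (fun _ => (0 : ℝ)) := by
  obtain ⟨B₀, hB₀⟩ := hbdd
  obtain ⟨B, hB0, hB⟩ : ∃ B : ℝ, 0 < B ∧ ∀ᵐ w ∂P, BoundedAt f g Θ B w := by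
    refine ⟨max 1 B₀, lt_max_of_lt_left one_pos, ?_⟩
    filter_upwards [hB₀] with w hw
    exact ⟨hw.1.trans (le_max_right _ _), fun θ hθ => (hw.2.1 θ hθ).trans (le_max_right _ _),
      fun τ => (hw.2.2 τ).trans (le_max_right _ _)⟩
  obtain ⟨ω₀⟩ := nonempty_of_isProbabilityMeasure μ
  have : Nonempty T := ⟨τhat 0 ω₀⟩
  obtain ⟨r, s, hr, hs, hrs⟩ := heq
  set Θ₀ := identifiedSet P f g Θ with hΘ₀
  have hS := tendstoInMeasure_iSup_sampleMoment hD_law hD_indep hf_meas hf_cont hθ₀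
    (hg_meas θ₀ hθ₀) hB0 hB hmodel hstar hcomplexity_f
  have hinf : ∀ θ : E, ⨅ θ' : Θ₀, ‖θ - (θ' : E)‖ = Metric.infDist θ Θ₀ := fun θ => by
    simp only [Metric.infDist_eq_iInf, dist_eq_norm]
  refine tendstoInMeasure_iff_norm.2 fun ε hε => ?_
  -- If `θhat` is `ε`-far from the identified set, it lies in the compact set `K`.
  set K : Set E := Θ ∩ {θ | ε ≤ Metric.infDist θ Θ₀} with hK
  have hKc : IsCompact K :=
    hΘ.inter_right (isClosed_le continuous_const (Metric.continuous_infDist_pt _))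
  have hKid : Disjoint K Θ₀ := Set.disjoint_left.2 fun θ hθ hθ' => by
    have h := hθ.2
    rw [Set.mem_ofPred_eq, Metric.infDist_zero_of_mem hθ'] at h
    exact absurd h (not_le.2 hε)
  obtain ⟨c, hc, hbad⟩ := exists_tendsto_measure_sampleMoment hD_law hD_indep hΘ hf_meas hg_meas
    hg_cont hstar hB hKc Set.inter_subset_left hKid
  -- The scaling `t` makes the linear gain `t * c` at least twice the quadratic penalty.
  set t : ℝ := min 1 (c / (2 * B ^ 4)) with ht
  have hB4 : 0 < B ^ 4 := by positivity
  have ht0 : 0 < t := lt_min one_pos (by positivity)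
  have ht1 : |t| ≤ 1 := by
    rw [abs_of_pos ht0]
    exact min_le_left _ _
  have htB : t * B ^ 4 ≤ c / 2 := by
    calc t * B ^ 4 ≤ c / (2 * B ^ 4) * B ^ 4 :=
          mul_le_mul_of_nonneg_right (min_le_right _ _) hB4.le
      _ = c / 2 := by field_simp
  set δ : ℝ := t * c / 6 with hδ
  have hδ0 : 0 < δ := by positivity
  have hlim := ((hbad.add (tendstoInMeasure_iff_norm.1 hr δ hδ0)).add
    (tendstoInMeasure_iff_norm.1 hs δ hδ0)).add (tendstoInMeasure_iff_norm.1 hS δ hδ0)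
  simp only [add_zero, sub_zero] at hlim
  refine tendsto_of_tendsto_of_tendsto_of_le_of_le tendsto_const_nhds hlim
    (fun _ => zero_le) fun n => ?_
  refine le_trans (measure_mono_ae ?_) ((measure_union_le _ _).trans (add_le_add_left
    ((measure_union_le _ _).trans (add_le_add_left (measure_union_le _ _) _)) _))
  filter_upwards [hrs n, ae_forall_sample hD_law hB] with ω hω hd hfar
  change ε ≤ ‖_ - (0 : ℝ)‖ at hfar
  change ω ∈ (_ ∪ _ ∪ _ ∪ _ : Set Ω)
  rw [sub_zero, hinf, Real.norm_of_nonneg Metric.infDist_nonneg] at hfar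
  by_contra hcon
  simp only [Set.mem_union, Set.mem_ofPred_eq, not_or, not_not, not_le, Real.norm_eq_abs] at hcon
  obtain ⟨⟨⟨hgood, hr'⟩, hs'⟩, hS'⟩ := hcon
  obtain ⟨τ, hτ⟩ := hgood (θhat n ω) ⟨hθhat n ω, hfar⟩
  have hgame := le_of_approxEquilibrium hd hstar hθ₀ (hθtilde n ω) (hθhat n ω) hω.1 hω.2 τ ht1
  have h1 : t * c < t * sampleMoment f g n (fun i => D i ω) τ (θhat n ω) :=
    mul_lt_mul_of_pos_left hτ ht0
  have h2 : t ^ 2 * B ^ 4 ≤ t * (c / 2) := by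
    rw [sq, mul_assoc]
    exact mul_le_mul_of_nonneg_left htB ht0.le
  linarith [(abs_lt.1 hr').2, (abs_lt.1 hs').2, (abs_lt.1 hS').2]
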